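/- Let $d\ge 1$, let $X=\{1,\dots,d\}$ be an alphabet, and let $T_d$ be the rooted $d$-regular tree whose vertices are the finite words over $X$. Every permutation $a\in S_d$ acts on $T_d$ by changing the first letter of a word, $xw\mapsto a(x)w$ (and fixes the empty word). Every element $b=(b_1,\dots,b_{d-1})\sigma$ of the permutational wreath product $B_d=S_d\wr (d-1)=S_d^{\,d-1}\rtimes S_{d-1}$ acts on $T_d$ by the recursion $b(xw)=\sigma(x)\,b_x(w)$ for $x\in\{1,\dots,d-1\}$ and $b(dw)=d\,b(w)$ (and fixes the empty word). The mother group $G_d$ of degree $d$ is the subgroup of $\mathrm{Aut}(T_d)$ generated by $S_d\cup B_d$ (equivalently, the image of the free product $S_d * B_d$). It is equipped with the word metric $d(g,h)=l(gh^{-1})$, where $l$ is the word length with respect to the finite symmetric generating set $S_d\cup B_d$. For a metric space $Y$ and an integer $n\ge 0$, one writes $\mathrm{asdim}\,Y\le n$ if for every $r>0$ one can write $Y=\bigcup_{i=0}^n Y_i$ so that each $Y_i$ is the union of a family of subsets $Y_{ij}$ which is $r$-disjoint (distinct members $U,U'$ of the family have $\inf\{d(u,u') : u\in U,\ u'\in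 U'\}>r$), with $\sup_{i,j}\mathrm{diam}\,Y_{ij}<\infty$. The asymptotic dimension $\mathrm{asdim}\,Y$ is the least such $n$, and it is $\infty$ if there is no such $n$. **Theorem 3.4 (Main Theorem 1).** For every integer $d>2$, the mother group $G_d$ has infinite asymptotic dimension: $\mathrm{asdim}\,G_d=\infty$. -/

import Mathlib

/-! ### The rooted `d`-regular tree and its automorphism group

The vertices are the finite words over the alphabet `Fin d`; the root is the empty word. -/

/-- Two words are adjacent if and only if one is obtained from the other by appending a letter. -/
def TreeAdj {d : ℕ} (u v : List (Fin d)) : Prop :=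
  (∃ x, v = u ++ [x]) ∨ (∃ x, u = v ++ [x])

/-- The group of automorphisms of the rooted `d`-regular tree: the bijections of the vertex set
that fix the root and preserve adjacency. The product is composition, `(g * h) w = g (h w)`. -/
def treeAut (d : ℕ) : Subgroup (Equiv.Perm (List (Fin d))) where
  carrier := {g | g [] = [] ∧ ∀ u v, TreeAdj (g u) (g v) ↔ TreeAdj u v}
  one_mem' := ⟨rfl, fun _ _ => Iff.rfl⟩
  mul_mem' := by
    rintro g h ⟨hg, hg'⟩ ⟨hh, hh'⟩
    refine ⟨?_, fun u v => ?_⟩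
    · rw [Equiv.Perm.mul_apply, hh, hg]
    · rw [Equiv.Perm.mul_apply, Equiv.Perm.mul_apply, hg', hh']
  inv_mem' := by
    rintro g ⟨hg, hg'⟩
    refine ⟨?_, fun u v => ?_⟩
    · rw [Equiv.Perm.inv_eq_iff_eq, hg]
    · simpa using (hg' (g⁻¹ u) (g⁻¹ v)).symm

theorem mem_treeAut_of {d : ℕ} (g : Equiv.Perm (List (Fin d))) (h0 : g [] = [])
    (h : ∀ u x, ∃ y, g (u ++ [x]) = g u ++ [y])
    (h' : ∀ u x, ∃ y, g.symm (u ++ [x]) = g.symm u ++ [y]) : g ∈ treeAut d := by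
  have key : ∀ (f : List (Fin d) → List (Fin d)), (∀ u x, ∃ y, f (u ++ [x]) = f u ++ [y]) →
      ∀ u v, TreeAdj u v → TreeAdj (f u) (f v) := by
    rintro f hf u v (⟨x, rfl⟩ | ⟨x, rfl⟩)
    · exact Or.inl (hf u x)
    · exact Or.inr (hf v x)
  refine ⟨h0, fun u v => ⟨fun huv => ?_, key g h u v⟩⟩
  simpa using key g.symm h' _ _ huv

/-! ### The generators of the mother group -/

/-- The action `x w ↦ a(x) w` on words of a permutation `a` of the alphabet:
`a = (1, …, 1) a`. -/
def rootedFun {d : ℕ} (a : Equiv.Perm (Fin d)) : List (Fin d) → List (Fin d)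
  | [] => []
  | x :: w => a x :: w

theorem rootedFun_leftInverse {d : ℕ} (a : Equiv.Perm (Fin d)) :
    Function.LeftInverse (rootedFun a⁻¹) (rootedFun a) := by
  rintro (_ | ⟨x, w⟩) <;> simp [rootedFun]

theorem rootedFun_append {d : ℕ} (a : Equiv.Perm (Fin d)) (u : List (Fin d)) (x : Fin d) :
    ∃ y, rootedFun a (u ++ [x]) = rootedFun a u ++ [y] := by
  rcases u with _ | ⟨z, u⟩ <;> simp [rootedFun]

/-- The automorphism of the tree given by a permutation `a` of the alphabet. -/
def rooted {d : ℕ} (a : Equiv.Perm (Fin d)) : treeAut d :=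
  ⟨{ toFun := rootedFun a
     invFun := rootedFun a⁻¹
     left_inv := rootedFun_leftInverse a
     right_inv := fun w => by simpa using rootedFun_leftInverse a⁻¹ w },
    mem_treeAut_of _ rfl (rootedFun_append a) (rootedFun_append a⁻¹)⟩

/-- The action on words of the element `b = (b₁, …, b_{d-1}) σ` of the permutational wreath product
`S_d ≀ (d - 1)`, defined by the recursion `b = (b₁, …, b_{d-1}, b) σ`, where `σ` permutes the first
`d - 1` letters: `x w ↦ σ(x) b_x(w)` if `x` is not the last letter, and `x w ↦ x b(w)` if `x` is
the last letter. -/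
def directedFun {d : ℕ} (b : Fin (d - 1) → Equiv.Perm (Fin d)) (σ : Equiv.Perm (Fin (d - 1))) :
    List (Fin d) → List (Fin d)
  | [] => []
  | x :: w =>
    if h : (x : ℕ) < d - 1 then
      Fin.castLE (Nat.sub_le d 1) (σ ⟨x, h⟩) :: rootedFun (b ⟨x, h⟩) w
    else x :: directedFun b σ w

/-- The first components of the inverse `(b', σ⁻¹)` of `(b, σ)`. -/
def directedInv {d : ℕ} (b : Fin (d - 1) → Equiv.Perm (Fin d)) (σ : Equiv.Perm (Fin (d - 1))) :
    Fin (d - 1) → Equiv.Perm (Fin d) :=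
  fun i => (b (σ⁻¹ i))⁻¹

theorem directedInv_directedInv {d : ℕ} (b : Fin (d - 1) → Equiv.Perm (Fin d))
    (σ : Equiv.Perm (Fin (d - 1))) : directedInv (directedInv b σ) σ⁻¹ = b := by
  funext i
  simp [directedInv]

theorem directedFun_leftInverse {d : ℕ} (b : Fin (d - 1) → Equiv.Perm (Fin d))
    (σ : Equiv.Perm (Fin (d - 1))) :
    Function.LeftInverse (directedFun (directedInv b σ) σ⁻¹) (directedFun b σ) := by
  intro w
  induction w with
  | nil => simp [directedFun]
  | cons x w ih =>
    by_cases h : (x : ℕ) < d - 1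
    · have := rootedFun_leftInverse (b ⟨x, h⟩) w
      simp [directedFun, h, directedInv, this]
    · simp [directedFun, h, ih]

theorem directedFun_append {d : ℕ} (b : Fin (d - 1) → Equiv.Perm (Fin d))
    (σ : Equiv.Perm (Fin (d - 1))) (u : List (Fin d)) (x : Fin d) :
    ∃ y, directedFun b σ (u ++ [x]) = directedFun b σ u ++ [y] := by
  induction u with
  | nil => by_cases h : (x : ℕ) < d - 1 <;> simp [directedFun, rootedFun, h]
  | cons z u ih =>
    by_cases h : (z : ℕ) < d - 1
    · simpa [directedFun, h] using rootedFun_append (b ⟨z, h⟩) u x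
    · simpa [directedFun, h] using ih

/-- The automorphism of the tree given by the element `b = (b₁, …, b_{d-1}) σ` of
`S_d ≀ (d - 1)`. -/
def directed {d : ℕ} (b : Fin (d - 1) → Equiv.Perm (Fin d)) (σ : Equiv.Perm (Fin (d - 1))) :
    treeAut d :=
  ⟨{ toFun := directedFun b σ
     invFun := directedFun (directedInv b σ) σ⁻¹
     left_inv := directedFun_leftInverse b σ
     right_inv := fun w => by
       simpa [directedInv_directedInv] using directedFun_leftInverse (directedInv b σ) σ⁻¹ w },
    mem_treeAut_of _ (by simp [directedFun]) (directedFun_append b σ) (directedFun_append _ _)⟩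

/-- The images of `S_d` and of `B_d = S_d ≀ (d - 1)` in the automorphism group of the tree. -/
def motherGenerators (d : ℕ) : Set (treeAut d) :=
  Set.range (fun a : Equiv.Perm (Fin d) => rooted a) ∪
    Set.range (fun p : (Fin (d - 1) → Equiv.Perm (Fin d)) × Equiv.Perm (Fin (d - 1)) =>
      directed p.1 p.2)

/-- The mother group of degree `d`: the subgroup of the automorphism group of the rooted
`d`-regular tree generated by `S_d` and `B_d`, that is, the image of the free product
`S_d ∗ B_d`. -/
def motherGroup (d : ℕ) : Subgroup (treeAut d) :=
  Subgroup.closure (motherGenerators d)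

/-- The generating set `S_d ∪ B_d` as a set of elements of the mother group. -/
def motherGenSet (d : ℕ) : Set (motherGroup d) :=
  {g | (g : treeAut d) ∈ motherGenerators d}

theorem motherGenSet_closure (d : ℕ) : Subgroup.closure (motherGenSet d) = ⊤ :=
  Subgroup.closure_closure_coe_preimage

theorem motherGenSet_inv (d : ℕ) : ∀ s ∈ motherGenSet d, s⁻¹ ∈ motherGenSet d := by
  rintro ⟨s, hs⟩ (⟨a, ha⟩ | ⟨⟨b, σ⟩, hb⟩)
  · refine Or.inl ⟨a⁻¹, ?_⟩
    change rooted a⁻¹ = s⁻¹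
    change rooted a = s at ha
    rw [← ha]
    exact Subtype.ext (Equiv.ext fun _ => rfl)
  · refine Or.inr ⟨⟨directedInv b σ, σ⁻¹⟩, ?_⟩
    change directed (directedInv b σ) σ⁻¹ = s⁻¹
    change directed b σ = s at hb
    rw [← hb]
    exact Subtype.ext (Equiv.ext fun _ => rfl)

/-! ### The word metric -/

/-- The lengths of the expressions of `g` as a product of elements of `S`. -/
def wordLengths {G : Type*} [Group G] (S : Set G) (g : G) : Set ℕ :=
  {n | ∃ l : List G, l.length = n ∧ (∀ s ∈ l, s ∈ S) ∧ l.prod = g}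

/-- The word length of `g` with respect to `S`. -/
noncomputable def wordLength {G : Type*} [Group G] (S : Set G) (g : G) : ℕ :=
  sInf (wordLengths S g)

theorem wordLengths_nonempty {G : Type*} [Group G] {S : Set G} (hS : Subgroup.closure S = ⊤)
    (hinv : ∀ s ∈ S, s⁻¹ ∈ S) (g : G) : (wordLengths S g).Nonempty := by
  have hg : g ∈ Subgroup.closure S := hS ▸ Subgroup.mem_top g
  rw [← Subgroup.mem_toSubmonoid, Subgroup.closure_toSubmonoid] at hg
  obtain ⟨l, hl, rfl⟩ := Submonoid.exists_list_of_mem_closure hg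
  refine ⟨l.length, l, rfl, fun s hs => ?_, rfl⟩
  rcases hl s hs with h | h
  · exact h
  · simpa using hinv _ h

theorem wordLength_one {G : Type*} [Group G] (S : Set G) : wordLength S 1 = 0 :=
  Nat.sInf_eq_zero.2 (Or.inl ⟨[], by simp⟩)

theorem eq_one_of_wordLength {G : Type*} [Group G] {S : Set G} (hS : Subgroup.closure S = ⊤)
    (hinv : ∀ s ∈ S, s⁻¹ ∈ S) {g : G} (hg : wordLength S g = 0) : g = 1 := by
  obtain ⟨l, hl, -, rfl⟩ := Nat.sInf_mem (wordLengths_nonempty hS hinv g)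
  have h0 : l.length = 0 := hl.trans hg
  rw [List.length_eq_zero_iff] at h0
  simp [h0]

theorem wordLength_mul_le {G : Type*} [Group G] {S : Set G} (hS : Subgroup.closure S = ⊤)
    (hinv : ∀ s ∈ S, s⁻¹ ∈ S) (g h : G) :
    wordLength S (g * h) ≤ wordLength S g + wordLength S h := by
  obtain ⟨l, hl, hl', hlg⟩ := Nat.sInf_mem (wordLengths_nonempty hS hinv g)
  obtain ⟨m, hm, hm', hmh⟩ := Nat.sInf_mem (wordLengths_nonempty hS hinv h)
  refine Nat.sInf_le ⟨l ++ m, ?_, fun s hs => ?_, ?_⟩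
  · rw [List.length_append, hl, hm]
    rfl
  · rcases List.mem_append.1 hs with h | h
    · exact hl' s h
    · exact hm' s h
  · rw [List.prod_append, hlg, hmh]

theorem wordLength_inv_le {G : Type*} [Group G] {S : Set G} (hS : Subgroup.closure S = ⊤)
    (hinv : ∀ s ∈ S, s⁻¹ ∈ S) (g : G) : wordLength S g⁻¹ ≤ wordLength S g := by
  obtain ⟨l, hl, hl', hlg⟩ := Nat.sInf_mem (wordLengths_nonempty hS hinv g)
  refine Nat.sInf_le ⟨(l.map fun x => x⁻¹).reverse, ?_, fun s hs => ?_, ?_⟩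
  · rw [List.length_reverse, List.length_map, hl]
    rfl
  · simp only [List.mem_reverse, List.mem_map] at hs
    obtain ⟨x, hx, rfl⟩ := hs
    exact hinv x (hl' x hx)
  · rw [← List.prod_inv_reverse, hlg]

/-- The word metric `d(g, h) = l(g h⁻¹)` of a group with a symmetric generating set. -/
@[reducible] noncomputable def wordMetricSpace {G : Type*} [Group G] (S : Set G)
    (hS : Subgroup.closure S = ⊤) (hinv : ∀ s ∈ S, s⁻¹ ∈ S) : MetricSpace G where
  dist g h := (wordLength S (g * h⁻¹) : ℝ)
  dist_self g := by simp [wordLength_one]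
  dist_comm g h := by
    have key : ∀ a b : G, wordLength S (a * b⁻¹) ≤ wordLength S (b * a⁻¹) := fun a b => by
      simpa using wordLength_inv_le hS hinv (b * a⁻¹)
    exact_mod_cast le_antisymm (key g h) (key h g)
  dist_triangle g h k := by
    have := wordLength_mul_le hS hinv (g * h⁻¹) (h * k⁻¹)
    rw [show g * h⁻¹ * (h * k⁻¹) = g * k⁻¹ by group] at this
    exact_mod_cast this
  eq_of_dist_eq_zero := by
    intro g h hgh
    exact mul_inv_eq_one.1 (eq_one_of_wordLength hS hinv (by exact_mod_cast hgh))

/-- The mother group carries the word metric of the generating set `S_d ∪ B_d`. -/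
noncomputable instance motherGroupMetricSpace (d : ℕ) : MetricSpace (motherGroup d) :=
  wordMetricSpace (motherGenSet d) (motherGenSet_closure d) (motherGenSet_inv d)

/-! ### Asymptotic dimension -/

/-- A family of subsets is `r`-disjoint if any two distinct members `A`, `B` satisfy
`d(A, B) > r`, where `d(A, B)` is the infimum of the distances between their points. -/
def RDisjoint {X : Type*} [MetricSpace X] (r : ℝ) (𝒰 : Set (Set X)) : Prop :=
  ∀ A ∈ 𝒰, ∀ B ∈ 𝒰, A ≠ B → ENNReal.ofReal r < ⨅ x ∈ A, ⨅ y ∈ B, edist x y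

/-- `asdim X ≤ n`: for every `r > 0` the space is covered by `n + 1` families of subsets, each
`r`-disjoint, all of whose members have diameter at most a common constant `D`. -/
def AsdimLE (X : Type*) [MetricSpace X] (n : ℕ) : Prop :=
  ∀ r : ℝ, 0 < r → ∃ 𝒰 : Fin (n + 1) → Set (Set X),
    (⋃ i, ⋃₀ 𝒰 i) = Set.univ ∧
    (∀ i, RDisjoint r (𝒰 i)) ∧
    ∃ D : ℝ, ∀ i, ∀ A ∈ 𝒰 i, ∀ x ∈ A, ∀ y ∈ A, dist x y ≤ D

/-- The asymptotic dimension: the least `n` with `asdim X ≤ n`, and `⊤` if there is none. -/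
noncomputable def asdim (X : Type*) [MetricSpace X] : ℕ∞ :=
  ⨅ (n : ℕ) (_ : AsdimLE X n), (n : ℕ∞)

/-! The mother group contains free abelian groups of every finite rank, and one of rank `k + 1`
rules out asymptotic dimension at most `k`.

Algebra: given three letters `x`, `y`, `z`, conjugating spinal elements by transpositions of letters
gives one element with a rooted section at `x` and another with a spinal section at `x`, whose other
nontrivial sections sit at different letters. Their commutator therefore lives below `x` alone. It
follows that the elements whose copy below `x` stays in the spinal group have finite index in it
(`exists_pow_mem_rigidPart`). Putting powers of a free abelian group below `x` and powers of an
element of infinite order below `y` raises the rank by one (`exists_free_abelian`).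

Geometry: a cover by `k + 1` families of bounded, well separated sets would label a large cube of
dimension `k + 1` so as to contradict Sperner's lemma (`exists_rainbow`,
`not_asdimLE_of_coarse_embedding`). The distortion of the abelian subgroup is irrelevant, since
balls of the word metric are finite. -/

/-! ### A cubical Sperner lemma

Chains are handled dually: a mod-2 cochain is a function on lists of points, a point being a
sequence of integers, of which only the first `n` coordinates matter in dimension `n`. -/

/-- The simplicial coboundary of a mod-2 cochain on lists. -/
def listCoboundary {P : Type*} : (List P → ZMod 2) → List P → ZMod 2
  | _, [] => 0
  | ω, x :: l => ω l + listCoboundary (fun l' => ω (x :: l')) l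

theorem listCoboundary_add {P : Type*} (ω η : List P → ZMod 2) (l : List P) :
    listCoboundary (fun l' => ω l' + η l') l = listCoboundary ω l + listCoboundary η l := by
  induction l generalizing ω η with
  | nil => simp [listCoboundary]
  | cons x l ih => simp only [listCoboundary, ih]; ring

theorem listCoboundary_zero {P : Type*} (l : List P) :
    listCoboundary (fun _ => 0) l = 0 := by
  induction l with
  | nil => rfl
  | cons x l ih => simp [listCoboundary, ih]

theorem listCoboundary_sum {P ι : Type*} (s : Finset ι) (ω : ι → List P → ZMod 2) (l : List P) :
    listCoboundary (fun l' => ∑ i ∈ s, ω i l') l = ∑ i ∈ s, listCoboundary (ω i) l := by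
  classical
  induction s using Finset.induction_on with
  | empty => simp [listCoboundary_zero]
  | insert a s ha ih => simp only [Finset.sum_insert ha, listCoboundary_add, ih]

theorem listCoboundary_map {P Q : Type*} (f : P → Q) (ω : List Q → ZMod 2) (l : List P) :
    listCoboundary (fun l' => ω (l'.map f)) l = listCoboundary ω (l.map f) := by
  induction l generalizing ω with
  | nil => rfl
  | cons x l ih =>
    simp only [listCoboundary, List.map_cons]
    rw [← ih]

theorem listCoboundary_multiset {P : Type*} [DecidableEq P] (w : Multiset P → ZMod 2)
    (l : List P) :
    listCoboundary (fun l' => w l') l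
      = ((l : Multiset P).map fun x => w ((l : Multiset P).erase x)).sum := by
  induction l generalizing w with
  | nil => simp [listCoboundary]
  | cons x l ih =>
    have := ih (fun s => w (x ::ₘ s))
    simp only [listCoboundary, ← Multiset.cons_coe, Multiset.map_cons, Multiset.sum_cons,
      Multiset.erase_cons_head]
    congr 1
    refine this.trans ?_
    congr 1
    refine Multiset.map_congr rfl fun z hz => ?_
    rw [Multiset.erase_cons_tail_of_mem hz]

/-- The cochain which is `1` on the lists that are rearrangements of `0, …, k - 1`. -/
def rainbow (k : ℕ) (l : List ℕ) : ZMod 2 :=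
  if (l : Multiset ℕ) = Multiset.range k then 1 else 0

/-- If deleting an entry `a` leaves `0, …, k - 1`, then either `a = k` and only that deletion works,
or `a < k` occurs twice and the two deletions cancel mod 2. -/
theorem listCoboundary_rainbow (k : ℕ) (l : List ℕ) (hl : ∀ a ∈ l, a ≤ k) :
    listCoboundary (rainbow k) l = rainbow (k + 1) l := by
  unfold rainbow
  rw [listCoboundary_multiset (fun s => if s = Multiset.range k then 1 else 0)]
  have h1 : ((l : Multiset ℕ).map fun x =>
      if (l : Multiset ℕ).erase x = Multiset.range k then (1 : ZMod 2) else 0)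
      = (l : Multiset ℕ).map fun x =>
        if (l : Multiset ℕ) = x ::ₘ Multiset.range k then (1 : ZMod 2) else 0 := by
    refine Multiset.map_congr rfl fun x hx => ?_
    congr 1
    refine propext ⟨fun h => ?_, fun h => ?_⟩
    · rw [← h, Multiset.cons_erase hx]
    · rw [h, Multiset.erase_cons_head]
  rw [h1, Multiset.range_succ]
  by_cases h : ∃ a, (l : Multiset ℕ) = a ::ₘ Multiset.range k
  · obtain ⟨a, ha⟩ := h
    have hak : a ≤ k := hl a (by rw [← Multiset.mem_coe, ha]; exact Multiset.mem_cons_self _ _)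
    have h2 : ∀ s : Multiset ℕ,
        (s.map fun x => if a = x then (1 : ZMod 2) else 0).sum = (s.count a : ZMod 2) := by
      intro s
      induction s using Multiset.induction_on with
      | empty => simp
      | cons b s ih =>
        rw [Multiset.map_cons, Multiset.sum_cons, ih, Multiset.count_cons]
        split_ifs <;> simp [add_comm]
    rw [ha]
    simp only [Multiset.cons_inj_left, h2, Multiset.count_cons_self]
    rcases hak.lt_or_eq with hlt | rfl
    · rw [Multiset.count_eq_one_of_mem (Multiset.nodup_range k) (Multiset.mem_range.2 hlt),
        if_neg hlt.ne]
      rfl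
    · rw [Multiset.count_eq_zero_of_notMem (by simp), if_pos rfl]
      rfl
  · rw [if_neg fun h' => h ⟨_, h'⟩]
    refine Multiset.sum_eq_zero fun z hz => ?_
    obtain ⟨x, -, rfl⟩ := Multiset.mem_map.1 hz
    exact if_neg fun h' => h ⟨_, h'⟩

theorem rainbow_eq_zero {k i : ℕ} {l : List ℕ} (hi : i < k) (h : i ∉ l) : rainbow k l = 0 := by
  refine if_neg fun h' => h ?_
  rw [← Multiset.mem_coe, h']
  exact Multiset.mem_range.2 hi

/-! ### Stokes' formula on the triangulated cube -/

/-- The dual of the prism operator on `[t, t + 1]` in the `n`-th coordinate. -/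
def prism (n : ℕ) (t : ℤ) :
    (List (ℕ → ℤ) → ZMod 2) → List (ℕ → ℤ) → ZMod 2
  | _, [] => 0
  -- Unfolded, this sums over `i` the lists `x₀, …, xᵢ` at height `t` followed by `xᵢ, …` at height
  -- `t + 1`: the standard triangulation of simplex times interval.
  | ω, x :: l =>
    ω (Function.update x n t :: Function.update x n (t + 1) ::
        l.map fun y => Function.update y n (t + 1))
      + prism n t (fun l' => ω (Function.update x n t :: l')) l

theorem prism_add (n : ℕ) (t : ℤ) (ω η : List (ℕ → ℤ) → ZMod 2) (l : List (ℕ → ℤ)) :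
    prism n t (fun l' => ω l' + η l') l = prism n t ω l + prism n t η l := by
  induction l generalizing ω η with
  | nil => simp [prism]
  | cons x l ih => simp only [prism, ih]; ring

/-- The chain homotopy formula, without signs mod 2: inner faces shared by consecutive simplices of
the prism cancel, leaving its top, its bottom and the prism over the boundary. -/
theorem prism_listCoboundary (n : ℕ) (t : ℤ) (ω : List (ℕ → ℤ) → ZMod 2) (l : List (ℕ → ℤ)) :
    prism n t (listCoboundary ω) l
      = ω (l.map fun y => Function.update y n (t + 1)) + ω (l.map fun y => Function.update y n t)
        + listCoboundary (prism n t ω) l := by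
  induction l generalizing ω with
  | nil => simp [prism, listCoboundary, CharTwo.add_self_eq_zero]
  | cons x l ih =>
    simp only [prism, listCoboundary, List.map_cons, listCoboundary_add, prism_add, ih,
      listCoboundary_map (fun y : ℕ → ℤ => Function.update y n (t + 1))
        (fun l' => ω (Function.update x n t :: Function.update x n (t + 1) :: l'))]
    linear_combination (CharTwo.add_self_eq_zero
      (ω (Function.update x n t :: l.map fun y => Function.update y n (t + 1))))

theorem prism_eq_zero (n : ℕ) (t : ℤ) (ω : List (ℕ → ℤ) → ZMod 2) (l : List (ℕ → ℤ))
    (h : ∀ l', (∀ q ∈ l', ∃ p ∈ l, q = Function.update p n t ∨ q = Function.update p n (t + 1)) →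
      ω l' = 0) : prism n t ω l = 0 := by
  induction l generalizing ω with
  | nil => rfl
  | cons x l ih =>
    rw [prism, h, ih, add_zero]
    · intro l' hl'
      refine h _ fun q hq => ?_
      rcases List.mem_cons.1 hq with rfl | hq
      · exact ⟨x, by simp, Or.inl rfl⟩
      · obtain ⟨p, hp, hpq⟩ := hl' q hq
        exact ⟨p, by simp [hp], hpq⟩
    · intro q hq
      simp only [List.mem_cons, List.mem_map] at hq
      rcases hq with rfl | rfl | ⟨p, hp, rfl⟩
      · exact ⟨x, by simp, Or.inl rfl⟩
      · exact ⟨x, by simp, Or.inr rfl⟩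
      · exact ⟨p, by simp [hp], Or.inr rfl⟩

/-- The value of a cochain on the fundamental chain of the triangulated cube `[0, m]ⁿ`. -/
def cubeSum (m : ℕ) : ℕ → (List (ℕ → ℤ) → ZMod 2) → ZMod 2
  | 0, ω => ω [0]
  | n + 1, ω => ∑ t ∈ Finset.range m, cubeSum m n (prism n t ω)

theorem cubeSum_add (m n : ℕ) (ω η : List (ℕ → ℤ) → ZMod 2) :
    cubeSum m n (fun l => ω l + η l) = cubeSum m n ω + cubeSum m n η := by
  induction n generalizing ω η with
  | zero => rfl
  | succ n ih =>
    simp only [cubeSum, ← Finset.sum_add_distrib, ← ih]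
    refine Finset.sum_congr rfl fun t _ => congrArg _ (funext fun l => prism_add _ _ _ _ _)

/-- Every simplex of the fundamental chain has its vertices in a single unit cube, because each
prism uses only two consecutive heights. -/
theorem cubeSum_eq_zero (m n : ℕ) (ω : List (ℕ → ℤ) → ZMod 2)
    (h : ∀ l, (∀ p ∈ l, ∀ q ∈ l, ∀ i < n, |p i - q i| ≤ 1) → ω l = 0) : cubeSum m n ω = 0 := by
  induction n generalizing ω with
  | zero => exact h _ (by simp)
  | succ n ih =>
    refine Finset.sum_eq_zero fun t _ => ih _ fun l hl => prism_eq_zero _ _ _ _ fun l' hl' => ?_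
    refine h _ fun p hp q hq i hi => ?_
    obtain ⟨p', hp', hpp⟩ := hl' p hp
    obtain ⟨q', hq', hqq⟩ := hl' q hq
    rcases Nat.lt_succ_iff_lt_or_eq.1 hi with hi | rfl
    · have : p i = p' i := by rcases hpp with rfl | rfl <;> simp [hi.ne]
      have : q i = q' i := by rcases hqq with rfl | rfl <;> simp [hi.ne]
      simp_all
    · rcases hpp with rfl | rfl <;> rcases hqq with rfl | rfl <;> simp

theorem cubeSum_zero (m n : ℕ) : cubeSum m n (fun _ => 0) = 0 :=
  cubeSum_eq_zero m n _ fun _ _ => rfl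

theorem cubeSum_sum {ι : Type*} (m n : ℕ) (s : Finset ι) (ω : ι → List (ℕ → ℤ) → ZMod 2) :
    cubeSum m n (fun l => ∑ i ∈ s, ω i l) = ∑ i ∈ s, cubeSum m n (ω i) := by
  classical
  induction s using Finset.induction_on with
  | empty => simp [cubeSum_zero]
  | insert a s ha ih => simp only [Finset.sum_insert ha, cubeSum_add, ih]

/-- The prism formula telescopes over the heights `t`, leaving the two faces orthogonal to the last
coordinate; the third term carries the lateral faces. -/
theorem cubeSum_succ_listCoboundary (m n : ℕ) (ω : List (ℕ → ℤ) → ZMod 2) :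
    cubeSum m (n + 1) (listCoboundary ω)
      = cubeSum m n (fun l => ω (l.map fun y => Function.update y n (m : ℤ)))
        + cubeSum m n (fun l => ω (l.map fun y => Function.update y n 0))
        + cubeSum m n (listCoboundary fun l => ∑ t ∈ Finset.range m, prism n t ω l) := by
  have h1 : ∀ t : ℕ, cubeSum m n (prism n t (listCoboundary ω))
      = cubeSum m n (fun l => ω (l.map fun y => Function.update y n ((t + 1 : ℕ) : ℤ)))
        + cubeSum m n (fun l => ω (l.map fun y => Function.update y n (t : ℤ)))
        + cubeSum m n (listCoboundary (prism n t ω)) := by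
    intro t
    rw [← cubeSum_add, ← cubeSum_add]
    push_cast
    exact congrArg _ (funext fun l => prism_listCoboundary n t ω l)
  have h2 : ∀ (g : ℕ → ZMod 2) (k : ℕ), ∑ t ∈ Finset.range k, (g (t + 1) + g t) = g k + g 0 := by
    intro g k
    simpa only [CharTwo.sub_eq_add] using Finset.sum_range_sub g k
  rw [cubeSum, Finset.sum_congr rfl fun t _ => h1 t, Finset.sum_add_distrib,
    h2 fun t : ℕ => cubeSum m n (fun l => ω (l.map fun y => Function.update y n (t : ℤ))),
    ← cubeSum_sum]
  congr 2
  exact funext fun l => (listCoboundary_sum _ _ _).symm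

/-- Stokes: the boundary of the cube lies in its faces. The condition `ω [] = 0` serves dimension
`0`, where the coboundary at a vertex is `ω []`. -/
theorem cubeSum_listCoboundary_eq_zero (m n : ℕ) (ω : List (ℕ → ℤ) → ZMod 2) (h0 : ω [] = 0)
    (h : ∀ l, ∀ i < n, ((∀ p ∈ l, p i = 0) ∨ ∀ p ∈ l, p i = (m : ℤ)) → ω l = 0) :
    cubeSum m n (listCoboundary ω) = 0 := by
  induction n generalizing ω with
  | zero => simp [cubeSum, listCoboundary, h0]
  | succ n ih =>
    have h1 : ∀ a : ℤ, (a = 0 ∨ a = m) →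
        (fun l : List (ℕ → ℤ) => ω (l.map fun y => Function.update y n a)) = fun _ => 0 := by
      refine fun a ha => funext fun l => h _ n n.lt_succ_self ?_
      rcases ha with rfl | rfl
      · left; simp
      · right; simp
    rw [cubeSum_succ_listCoboundary, h1 m (Or.inr rfl), h1 0 (Or.inl rfl), cubeSum_zero, ih]
    · simp
    · exact Finset.sum_eq_zero fun t _ => rfl
    · refine fun l i hi hl => Finset.sum_eq_zero fun t _ =>
        prism_eq_zero _ _ _ _ fun l' hl' => h l' i (hi.trans n.lt_succ_self) ?_
      have key : ∀ q ∈ l', ∃ p ∈ l, q i = p i := fun q hq => by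
        obtain ⟨p, hp, rfl | rfl⟩ := hl' q hq <;> exact ⟨p, hp, by simp [hi.ne]⟩
      refine hl.imp (fun hl q hq => ?_) fun hl q hq => ?_
      all_goals
        obtain ⟨p, hp, e⟩ := key q hq
        rw [e, hl p hp]

/-- Sperner's parity count, by induction on the dimension. The rainbow cochain is a coboundary, so
the count moves to the boundary. Label `i` is missing where `xᵢ = m`, and label `n` is missing where
`xᵢ = 0` with `i < n`; only the face `xₙ = 0` contributes, and it is the case of dimension `n`. -/
theorem cubeSum_rainbow (m n : ℕ) (lab : (ℕ → ℤ) → ℕ) (hn : ∀ p, lab p ≤ n)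
    (hm : ∀ p, ∀ i < n, p i = (m : ℤ) → lab p ≠ i) (h0 : ∀ p, ∀ i < n, p i = 0 → lab p ≤ i) :
    cubeSum m n (fun l => rainbow (n + 1) (l.map lab)) = 1 := by
  induction n generalizing lab with
  | zero =>
    have : lab 0 = 0 := Nat.le_zero.1 (hn 0)
    simp [cubeSum, rainbow, this]
  | succ n ih =>
    have h1 : (fun l : List (ℕ → ℤ) => rainbow (n + 1 + 1) (l.map lab))
        = listCoboundary fun l => rainbow (n + 1) (l.map lab) := by
      funext l
      rw [listCoboundary_map, listCoboundary_rainbow]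
      intro a ha
      obtain ⟨p, -, rfl⟩ := List.mem_map.1 ha
      exact hn p
    have h2 : cubeSum m n (fun l => rainbow (n + 1)
        ((l.map fun y => Function.update y n (m : ℤ)).map lab)) = 0 := by
      refine cubeSum_eq_zero _ _ _ fun l _ => rainbow_eq_zero n.lt_succ_self fun hmem => ?_
      simp only [List.map_map, List.mem_map, Function.comp] at hmem
      obtain ⟨p, -, hp⟩ := hmem
      exact hm _ n n.lt_succ_self (by simp) hp
    have h3 : cubeSum m n (fun l => rainbow (n + 1)
        ((l.map fun y => Function.update y n 0).map lab)) = 1 := by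
      have := ih (fun p => lab (Function.update p n 0)) (fun p => h0 _ n n.lt_succ_self (by simp))
        (fun p i hi hp => hm _ i (hi.trans n.lt_succ_self) (by simpa [hi.ne] using hp))
        (fun p i hi hp => h0 _ i (hi.trans n.lt_succ_self) (by simpa [hi.ne] using hp))
      simpa only [List.map_map, Function.comp_def] using this
    rw [h1, cubeSum_succ_listCoboundary, h2, h3, cubeSum_listCoboundary_eq_zero, zero_add, add_zero]
    · exact Finset.sum_eq_zero fun t _ => rfl
    · refine fun l i hi hl => Finset.sum_eq_zero fun t _ => prism_eq_zero _ _ _ _ fun l' hl' => ?_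
      have key : ∀ q ∈ l', ∃ p ∈ l, q i = p i := fun q hq => by
        obtain ⟨p, hp, rfl | rfl⟩ := hl' q hq <;> exact ⟨p, hp, by simp [hi.ne]⟩
      rcases hl with hl | hl
      · refine rainbow_eq_zero n.lt_succ_self fun hmem => ?_
        obtain ⟨q, hq, e⟩ := List.mem_map.1 hmem
        obtain ⟨p, hp, e'⟩ := key q hq
        have := h0 q i (hi.trans n.lt_succ_self) (e'.trans (hl p hp))
        omega
      · refine rainbow_eq_zero (hi.trans n.lt_succ_self) fun hmem => ?_
        obtain ⟨q, hq, e⟩ := List.mem_map.1 hmem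
        obtain ⟨p, hp, e'⟩ := key q hq
        exact hm q i (hi.trans n.lt_succ_self) (e'.trans (hl p hp)) e

/-- A cubical Sperner lemma: if a labelling of `ℤⁿ` by `0, …, n` avoids the label `i` where
`xᵢ = m` and the labels above `i` where `xᵢ = 0`, then some pairwise adjacent points carry all the
labels. -/
theorem exists_rainbow (m n : ℕ) (lab : (ℕ → ℤ) → ℕ) (hn : ∀ p, lab p ≤ n)
    (hm : ∀ p, ∀ i < n, p i = (m : ℤ) → lab p ≠ i) (h0 : ∀ p, ∀ i < n, p i = 0 → lab p ≤ i) :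
    ∃ v : Fin (n + 1) → ℕ → ℤ, (∀ j, lab (v j) = j) ∧
      ∀ j k, ∀ i < n, |v j i - v k i| ≤ 1 := by
  by_contra hcon
  have h1 := cubeSum_rainbow m n lab hn hm h0
  rw [cubeSum_eq_zero] at h1
  · exact zero_ne_one h1
  · refine fun l hl => if_neg fun h => hcon ?_
    have : ∀ j : Fin (n + 1), ∃ p ∈ l, lab p = j := fun j => by
      have hj : (j : ℕ) ∈ ((l.map lab : List ℕ) : Multiset ℕ) := by
        rw [h]; exact Multiset.mem_range.2 j.2
      simpa using hj
    choose v hv hv' using this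
    exact ⟨v, hv', fun j k => hl _ (hv j) _ (hv k)⟩

/-! ### Lower bound for the asymptotic dimension -/

/-- A space containing a coarse image of `ℤ^(k + 1)` does not have asymptotic dimension at most
`k`. -/
theorem not_asdimLE_of_coarse_embedding {X : Type*} [MetricSpace X] (k : ℕ) (f : (ℕ → ℤ) → X)
    (C : ℝ) (hC : ∀ p q, (∀ i < k + 1, |p i - q i| ≤ 1) → dist (f p) (f q) ≤ C)
    (hf : ∀ D : ℝ, ∃ m : ℕ, ∀ p q, dist (f p) (f q) ≤ D → ∀ i < k + 1, |p i - q i| < m) :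
    ¬ AsdimLE X k := by
  classical
  intro hX
  -- The maximum with `1` only makes the scale positive.
  obtain ⟨𝒰, hcov, hdis, D, hD⟩ := hX (max C 1) (by positivity)
  obtain ⟨m, hm⟩ := hf D
  have hmem : ∀ p, ∃ c, ∃ A ∈ 𝒰 c, f p ∈ A := fun p => by
    have : f p ∈ ⋃ i, ⋃₀ 𝒰 i := hcov ▸ Set.mem_univ _
    simpa using this
  choose c A hA hpA using hmem
  -- The label of `p` is the first `i` such that `A p` misses the face `xᵢ = m`, or else `k + 1`. It
  -- depends on `A p` alone, so different labels force different sets.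
  have hex : ∀ S : Set X, ∃ i, i = k + 1 ∨ ∀ q, f q ∈ S → q i ≠ m := fun S => ⟨k + 1, Or.inl rfl⟩
  obtain ⟨v, hv, hv'⟩ := exists_rainbow m (k + 1) (fun p => Nat.find (hex (A p)))
    (fun p => Nat.find_min' _ (Or.inl rfl))
    (fun p i hi hp he => by
      rcases Nat.find_spec (hex (A p)) with h | h
      · omega
      · exact h p (hpA p) (by rw [he]; exact hp))
    -- A set of diameter at most `D` cannot meet both `xᵢ = 0` and `xᵢ = m`.
    (fun p i hi hp => Nat.find_min' _ (Or.inr fun q hq hqm => by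
      have := hm q p (hD _ _ (hA p) _ hq _ (hpA p)) i hi
      simp [hp, hqm] at this))
  -- There are `k + 2` labels but `k + 1` families: two adjacent points lie in distinct members of
  -- one family, which are too close to each other.
  obtain ⟨j, j', hjj, hc⟩ := Fintype.exists_ne_map_eq_of_card_lt (fun j => c (v j))
    (by simp : Fintype.card (Fin (k + 1)) < Fintype.card (Fin (k + 1 + 1)))
  have hc : c (v j) = c (v j') := hc
  have hAA : A (v j) ≠ A (v j') := fun h => hjj (Fin.ext (by
    have h1 := hv j
    have h2 := hv j'
    simp only [h] at h1
    exact h1.symm.trans h2))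
  have h1 := hdis _ _ (hA (v j)) _ (hc ▸ hA (v j')) hAA
  have h2 : (⨅ x ∈ A (v j), ⨅ y ∈ A (v j'), edist x y) ≤ edist (f (v j)) (f (v j')) :=
    (iInf₂_le _ (hpA _)).trans (iInf₂_le _ (hpA _))
  rw [edist_dist] at h2
  exact absurd (h1.trans_le h2) (not_lt.2 (ENNReal.ofReal_le_ofReal
    ((hC _ _ (hv' j j')).trans (le_max_left _ _))))

/-! ### Automorphisms of the tree of words and their sections -/

section Words

open scoped commutatorElement

variable {α : Type*}

/-- The permutation `x w ↦ x gₓ(w)` of the words given by permutations `gₓ` of the words. -/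
def diagPerm : (α → Equiv.Perm (List α)) →* Equiv.Perm (List α) where
  toFun g :=
    { toFun := fun w => match w with
        | [] => []
        | x :: w => x :: g x w
      invFun := fun w => match w with
        | [] => []
        | x :: w => x :: (g x)⁻¹ w
      left_inv := by rintro (_ | ⟨x, w⟩) <;> simp
      right_inv := by rintro (_ | ⟨x, w⟩) <;> simp }
  map_one' := by ext1 w; cases w <;> rfl
  map_mul' g h := by ext1 w; cases w <;> rfl

@[simp] theorem diagPerm_nil (g : α → Equiv.Perm (List α)) : diagPerm g [] = [] := rfl

@[simp] theorem diagPerm_cons (g : α → Equiv.Perm (List α)) (x : α) (w : List α) :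
    diagPerm g (x :: w) = x :: g x w := rfl

theorem diagPerm_injective : Function.Injective (diagPerm (α := α)) := by
  intro g h e
  funext x
  ext1 w
  simpa using congrArg (fun k : Equiv.Perm (List α) => k (x :: w)) e

/-- The permutation `x w ↦ a(x) w` of the words. -/
def letterPerm : Equiv.Perm α →* Equiv.Perm (List α) where
  toFun a :=
    { toFun := fun w => match w with
        | [] => []
        | x :: w => a x :: w
      invFun := fun w => match w with
        | [] => []
        | x :: w => a⁻¹ x :: w
      left_inv := by rintro (_ | ⟨x, w⟩) <;> simp
      right_inv := by rintro (_ | ⟨x, w⟩) <;> simp }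
  map_one' := by ext1 w; cases w <;> rfl
  map_mul' g h := by ext1 w; cases w <;> rfl

@[simp] theorem letterPerm_nil (a : Equiv.Perm α) : letterPerm a [] = [] := rfl

@[simp] theorem letterPerm_cons (a : Equiv.Perm α) (x : α) (w : List α) :
    letterPerm a (x :: w) = a x :: w := rfl

theorem letterPerm_conj_diagPerm (a : Equiv.Perm α) (g : α → Equiv.Perm (List α)) :
    letterPerm a * diagPerm g * (letterPerm a)⁻¹ = diagPerm fun x => g (a⁻¹ x) := by
  rw [mul_inv_eq_iff_eq_mul]
  ext1 w
  cases w <;> simp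

variable [DecidableEq α]

/-- The permutation `y w ↦ y a(w)`, `z w ↦ z b(w)`, where `b` is the permutation itself, fixing
the words that begin with other letters. -/
def spinalFun (y z : α) (a : Equiv.Perm α) : List α → List α
  | [] => []
  | x :: w => if x = z then x :: spinalFun y z a w else if x = y then x :: letterPerm a w else x :: w

theorem spinalFun_mul (y z : α) (a b : Equiv.Perm α) (w : List α) :
    spinalFun y z (a * b) w = spinalFun y z a (spinalFun y z b w) := by
  induction w with
  | nil => rfl
  | cons x w ih =>
    by_cases h : x = z
    · simp [spinalFun, h, ih]
    · by_cases h' : x = y <;> simp_all [spinalFun]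

theorem spinalFun_one (y z : α) (w : List α) : spinalFun y z 1 w = w := by
  induction w with
  | nil => rfl
  | cons x w ih => simp [spinalFun, ih]

/-- The spinal elements `b = (…, a, …, b)` with `a` at the letter `y` and `b` at the letter `z`. -/
def spinal (y z : α) : Equiv.Perm α →* Equiv.Perm (List α) where
  toFun a :=
    { toFun := spinalFun y z a
      invFun := spinalFun y z a⁻¹
      left_inv := fun w => by rw [← spinalFun_mul, inv_mul_cancel, spinalFun_one]
      right_inv := fun w => by rw [← spinalFun_mul, mul_inv_cancel, spinalFun_one] }
  map_one' := Equiv.ext (spinalFun_one y z)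
  map_mul' a b := Equiv.ext (spinalFun_mul y z a b)

theorem spinal_eq_diagPerm (y z : α) (a : Equiv.Perm α) :
    spinal y z a
      = diagPerm fun x => if x = z then spinal y z a else if x = y then letterPerm a else 1 := by
  ext1 w
  rcases w with _ | ⟨x, w⟩
  · rfl
  · change spinalFun y z a (x :: w) = _
    rw [diagPerm_cons, spinalFun]
    split_ifs <;> rfl

theorem spinal_cons_self (y z : α) (a : Equiv.Perm α) (w : List α) :
    spinal y z a (z :: w) = z :: spinal y z a w := by
  change spinalFun y z a (z :: w) = _
  rw [spinalFun, if_pos rfl]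
  rfl

/-- The permutation acting as `g` below the letter `x` and trivially elsewhere. -/
def atLetter (x : α) : Equiv.Perm (List α) →* Equiv.Perm (List α) :=
  diagPerm.comp (MonoidHom.mulSingle (fun _ : α => Equiv.Perm (List α)) x)

theorem atLetter_apply (x : α) (g : Equiv.Perm (List α)) :
    atLetter x g = diagPerm (Pi.mulSingle x g) := rfl

theorem letterPerm_conj_atLetter (a : Equiv.Perm α) (x : α) (g : Equiv.Perm (List α)) :
    letterPerm a * atLetter x g * (letterPerm a)⁻¹ = atLetter (a x) g := by
  rw [atLetter_apply, letterPerm_conj_diagPerm, atLetter_apply]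
  congr 1
  funext z
  by_cases h : z = a x
  · subst h; simp
  · rw [Pi.mulSingle_eq_of_ne h, Pi.mulSingle_eq_of_ne]
    rintro h'
    exact h (by simp [← h'])

theorem diagPerm_conj_atLetter (s : α → Equiv.Perm (List α)) (x : α) (g : Equiv.Perm (List α)) :
    diagPerm s * atLetter x g * (diagPerm s)⁻¹ = atLetter x (s x * g * (s x)⁻¹) := by
  rw [atLetter_apply, atLetter_apply, ← map_inv, ← map_mul, ← map_mul]
  congr 1
  funext z
  by_cases h : z = x
  · subst h; simp
  · simp [Pi.mulSingle_eq_of_ne h]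

theorem atLetter_commute {x y : α} (h : x ≠ y) (g k : Equiv.Perm (List α)) :
    Commute (atLetter x g) (atLetter y k) :=
  (Pi.mulSingle_commute (f := fun _ : α => Equiv.Perm (List α)) h g k).map diagPerm

theorem atLetter_mul_atLetter_eq_one_iff {x y : α} (h : x ≠ y) (g k : Equiv.Perm (List α)) :
    atLetter x g * atLetter y k = 1 ↔ g = 1 ∧ k = 1 := by
  refine ⟨fun e => ?_, by rintro ⟨rfl, rfl⟩; simp⟩
  rw [atLetter_apply, atLetter_apply, ← map_mul, ← map_one diagPerm] at e
  have e := diagPerm_injective e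
  refine ⟨?_, ?_⟩
  · simpa [Pi.mulSingle_eq_of_ne h] using congrFun e x
  · simpa [Pi.mulSingle_eq_of_ne h.symm] using congrFun e y

/-! ### The subgroup generated by rooted and spinal elements -/

/-- The group generated by the permutations of the first letter and the spinal elements. -/
def spinalGroup (y z : α) : Subgroup (Equiv.Perm (List α)) :=
  (letterPerm (α := α)).range ⊔ (spinal y z).range

theorem letterPerm_mem (y z : α) (a : Equiv.Perm α) : letterPerm a ∈ spinalGroup y z :=
  (le_sup_left : _ ≤ spinalGroup y z) ⟨a, rfl⟩

theorem spinal_mem (y z : α) (a : Equiv.Perm α) : spinal y z a ∈ spinalGroup y z :=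
  (le_sup_right : _ ≤ spinalGroup y z) ⟨a, rfl⟩

theorem letterPerm_conj_mem {y z : α} (a : Equiv.Perm α) {g : Equiv.Perm (List α)}
    (hg : g ∈ spinalGroup y z) : letterPerm a * g * (letterPerm a)⁻¹ ∈ spinalGroup y z :=
  mul_mem (mul_mem (letterPerm_mem _ _ _) hg) (inv_mem (letterPerm_mem _ _ _))

/-- The elements whose copies below the letter `x` belong to the group `spinalGroup y z`. -/
def rigidPart (x y z : α) : Subgroup (Equiv.Perm (List α)) :=
  (spinalGroup y z).comap (atLetter x)

theorem mem_rigidPart {x y z : α} {g : Equiv.Perm (List α)} :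
    g ∈ rigidPart x y z ↔ atLetter x g ∈ spinalGroup y z := Iff.rfl

/-- Conjugating by the transposition of `x` and `y` moves the rooted section from `y` to `x`.
Together with `exists_section_spinal`, this makes every generator the section at `x` of an element
of the group that fixes all first letters. -/
theorem exists_section_letterPerm {x y z : α} (hxy : x ≠ y) (hxz : x ≠ z) (hyz : y ≠ z)
    (a : Equiv.Perm α) :
    diagPerm (fun v => if v = z then spinal y z a else if v = x then letterPerm a else 1)
      ∈ spinalGroup y z := by
  have h := letterPerm_conj_mem (Equiv.swap x y) (spinal_mem y z a)
  rw [spinal_eq_diagPerm, letterPerm_conj_diagPerm] at h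
  convert h using 3 with v
  simp only [Equiv.swap_inv, Equiv.swap_apply_def]
  split_ifs <;> simp_all

theorem exists_section_spinal {x y z : α} (hxy : x ≠ y) (hxz : x ≠ z) (hyz : y ≠ z)
    (a : Equiv.Perm α) :
    diagPerm (fun v => if v = x then spinal y z a else if v = y then letterPerm a else 1)
      ∈ spinalGroup y z := by
  have h := letterPerm_conj_mem (Equiv.swap x z) (spinal_mem y z a)
  rw [spinal_eq_diagPerm, letterPerm_conj_diagPerm] at h
  convert h using 3 with v
  simp only [Equiv.swap_inv, Equiv.swap_apply_def]
  split_ifs <;> simp_all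

/-- The two elements just built have sections supported on `{x, z}` and `{x, y}`. They commute away
from `x`, so their commutator is a copy below `x`. This is where a third letter is needed. -/
theorem commutator_mem_rigidPart {x y z : α} (hxy : x ≠ y) (hxz : x ≠ z) (hyz : y ≠ z)
    (a c : Equiv.Perm α) : ⁅letterPerm a, spinal y z c⁆ ∈ rigidPart x y z := by
  have h1 := exists_section_letterPerm hxy hxz hyz a
  have h2 := exists_section_spinal hxy hxz hyz c
  have h3 := mul_mem (mul_mem (mul_mem h1 h2) (inv_mem h1)) (inv_mem h2)
  rw [mem_rigidPart, atLetter_apply, commutatorElement_def]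
  rw [← map_inv, ← map_inv, ← map_mul, ← map_mul, ← map_mul] at h3
  convert h3 using 2
  funext v
  by_cases hx : v = x
  · subst hx
    simp [hxz]
  · by_cases hz : v = z
    · subst hz
      simp [hx, hyz.symm]
    · simp [hx, hz]

/-- Conjugating a copy below `x` by an element fixing all first letters conjugates it by the section
at `x`, and every generator is such a section. -/
theorem spinalGroup_le_normalizer {x y z : α} (hxy : x ≠ y) (hxz : x ≠ z) (hyz : y ≠ z) :
    spinalGroup y z ≤ Subgroup.normalizer (rigidPart x y z : Set (Equiv.Perm (List α))) := by
  have key : ∀ s : α → Equiv.Perm (List α), diagPerm s ∈ spinalGroup y z →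
      s x ∈ Subgroup.normalizer (rigidPart x y z : Set (Equiv.Perm (List α))) := by
    intro s hs
    rw [Subgroup.mem_normalizer_iff]
    intro g
    rw [mem_rigidPart, mem_rigidPart, ← diagPerm_conj_atLetter]
    rw [Subgroup.mul_mem_cancel_right _ (inv_mem hs), Subgroup.mul_mem_cancel_left _ hs]
  refine sup_le ?_ ?_
  · rintro _ ⟨a, rfl⟩
    simpa [hxz] using key _ (exists_section_letterPerm hxy hxz hyz a)
  · rintro _ ⟨a, rfl⟩
    simpa using key _ (exists_section_spinal hxy hxz hyz a)

/-! ### Finite index of the rigid part and free abelian subgroups -/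

/-- Some positive power of every element of `spinalGroup y z` lies in the rigid part. -/
theorem exists_pow_mem_rigidPart [Finite α] {x y z : α} (hxy : x ≠ y) (hxz : x ≠ z)
    (hyz : y ≠ z) :
    ∃ N : ℕ, 0 < N ∧ ∀ g ∈ spinalGroup y z, g ^ N ∈ rigidPart x y z := by
  set H := spinalGroup y z
  set M := (rigidPart x y z).subgroupOf H
  have hM : M.Normal := Subgroup.normal_subgroupOf_of_le_normalizer
    (spinalGroup_le_normalizer hxy hxz hyz)
  -- Modulo `M` rooted and spinal generators commute, so the quotient is an image of a product of
  -- two finite groups. Its order serves as `N`.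
  let r : Equiv.Perm α →* H ⧸ M := (QuotientGroup.mk' M).comp
    (letterPerm.codRestrict H (letterPerm_mem y z))
  let b : Equiv.Perm α →* H ⧸ M := (QuotientGroup.mk' M).comp
    ((spinal y z).codRestrict H (spinal_mem y z))
  have hrb : ∀ a c, Commute (r a) (b c) := by
    intro a c
    rw [← commutatorElement_eq_one_iff_commute]
    have h1 : ⁅r a, b c⁆ = QuotientGroup.mk' M
        ⁅letterPerm.codRestrict H (letterPerm_mem y z) a,
          (spinal y z).codRestrict H (spinal_mem y z) c⁆ := by
      rw [map_commutatorElement]; rfl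
    rw [h1, QuotientGroup.mk'_apply, QuotientGroup.eq_one_iff, Subgroup.mem_subgroupOf]
    exact commutator_mem_rigidPart hxy hxz hyz a c
  have hsurj : Function.Surjective (r.noncommCoprod b hrb) := by
    rw [← MonoidHom.range_eq_top, MonoidHom.noncommCoprod_range]
    have h1 : (letterPerm.codRestrict H (letterPerm_mem y z)).range
        ⊔ ((spinal y z).codRestrict H (spinal_mem y z)).range = ⊤ := by
      apply Subgroup.map_injective H.subtype_injective
      rw [Subgroup.map_sup, MonoidHom.map_range, MonoidHom.map_range, ← MonoidHom.range_eq_map,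
        Subgroup.range_subtype]
      rfl
    rw [MonoidHom.range_comp, MonoidHom.range_comp, ← Subgroup.map_sup, h1,
      ← MonoidHom.range_eq_map, MonoidHom.range_eq_top]
    exact QuotientGroup.mk'_surjective M
  have hfin : Finite (H ⧸ M) := Finite.of_surjective _ hsurj
  refine ⟨Nat.card (H ⧸ M), Nat.card_pos, fun g hg => ?_⟩
  have h1 : ((⟨g, hg⟩ : H) : H ⧸ M) ^ Nat.card (H ⧸ M) = 1 := pow_card_eq_one'
  rw [← QuotientGroup.mk_pow, QuotientGroup.eq_one_iff, Subgroup.mem_subgroupOf] at h1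
  exact h1

/-- A variant of the odometer: `c` exchanges the words `y` and `z`, and `c ^ 2` acts below `z` as
`c` itself. An odd power of `c` is thus nontrivial, and an even exponent killing `c` can be halved.
-/
theorem exists_not_isOfFinOrder {y z : α} (hyz : y ≠ z) :
    ∃ c ∈ spinalGroup y z, ¬ IsOfFinOrder c := by
  set s := Equiv.swap y z
  set c := letterPerm s * spinal y z s with hc
  have hyw : ∀ w, c (y :: w) = z :: letterPerm s w := fun w => by
    rw [hc, Equiv.Perm.mul_apply, spinal_eq_diagPerm]
    simp [hyz, s]
  have hzw : ∀ w, c (z :: w) = y :: spinal y z s w := fun w => by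
    rw [hc, Equiv.Perm.mul_apply, spinal_cons_self, letterPerm_cons, Equiv.swap_apply_right]
  have h2 : ∀ w, (c ^ 2) (z :: w) = z :: c w := fun w => by
    rw [sq, Equiv.Perm.mul_apply, hzw, hyw]
    rfl
  have h2k : ∀ (k : ℕ) w, (c ^ (2 * k)) (z :: w) = z :: (c ^ k) w := by
    intro k
    induction k with
    | zero => simp
    | succ k ih =>
      intro w
      rw [mul_add, mul_one, pow_add, Equiv.Perm.mul_apply, h2, ih, pow_succ c k]
      rfl
  refine ⟨c, mul_mem (letterPerm_mem _ _ _) (spinal_mem _ _ _), ?_⟩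
  rw [isOfFinOrder_iff_pow_eq_one]
  rintro ⟨n, hn, hcn⟩
  induction n using Nat.strong_induction_on with
  | _ n ih =>
    rcases Nat.even_or_odd' n with ⟨k, rfl | rfl⟩
    · refine ih k (by omega) (by omega) (Equiv.ext fun w => ?_)
      simpa [hcn] using (h2k k w).symm
    · have h3 := h2k k []
      have h4 : (c ^ (2 * k + 1)) [z] = [z] := by rw [hcn]; rfl
      rw [pow_succ', Equiv.Perm.mul_apply, h3, hzw] at h4
      exact hyz (List.cons.inj h4).1

/-- The group `spinalGroup y z` contains free abelian groups of every finite rank. -/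
theorem exists_free_abelian [Finite α] {x y z : α} (hxy : x ≠ y) (hxz : x ≠ z) (hyz : y ≠ z)
    (n : ℕ) :
    ∃ f : Multiplicative (ℕ → ℤ) →* Equiv.Perm (List α), (∀ p, f p ∈ spinalGroup y z) ∧
      ∀ p : ℕ → ℤ, f (Multiplicative.ofAdd p) = 1 ↔ ∀ i < n, p i = 0 := by
  induction n with
  | zero => exact ⟨1, fun p => one_mem _, by simp⟩
  | succ n ih =>
    obtain ⟨f, hf, hf1⟩ := ih
    obtain ⟨c, hc, hc1⟩ := exists_not_isOfFinOrder hyz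
    obtain ⟨N, hN, hNM⟩ := exists_pow_mem_rigidPart hxy hxz hyz
    have hy : ∀ g ∈ rigidPart x y z, atLetter y g ∈ spinalGroup y z := fun g hg => by
      simpa [letterPerm_conj_atLetter] using letterPerm_conj_mem (Equiv.swap x y) hg
    let ev : Multiplicative (ℕ → ℤ) →* Multiplicative ℤ :=
      AddMonoidHom.toMultiplicative (Pi.evalAddMonoidHom (fun _ : ℕ => ℤ) n)
    -- The `N`-th power brings both factors into the rigid part. It is taken in the commutative
    -- source, where it is a homomorphism; it leaves the kernels unchanged, as `ℤ` has no torsion.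
    let f₁ := ((atLetter x).comp f).comp (powMonoidHom N)
    let f₂ := ((atLetter y).comp (zpowersHom _ c)).comp (ev.comp (powMonoidHom N))
    refine ⟨(f₁.noncommCoprod f₂ fun p q => atLetter_commute hxy _ _).comp
      ((MonoidHom.id _).prod (MonoidHom.id _)), fun p => ?_, fun p => ?_⟩
    · refine mul_mem ?_ (hy _ ?_)
      · change atLetter x (f (p ^ N)) ∈ _
        rw [map_pow]
        exact hNM _ (hf p)
      · change zpowersHom _ c (ev (p ^ N)) ∈ _
        rw [map_pow, map_pow]
        exact hNM _ (zpow_mem hc _)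
    · change atLetter x (f (Multiplicative.ofAdd p ^ N)) * atLetter y (zpowersHom _ c
        (ev (Multiplicative.ofAdd p ^ N))) = 1 ↔ _
      rw [atLetter_mul_atLetter_eq_one_iff hxy]
      have h1 : zpowersHom _ c (ev (Multiplicative.ofAdd p ^ N)) = c ^ ((N : ℤ) * p n) := by
        rw [zpowersHom_apply]
        congr 1
      have h2 : f (Multiplicative.ofAdd p ^ N) = f (Multiplicative.ofAdd (N • p)) := rfl
      rw [h1, h2, hf1]
      have h3 : c ^ ((N : ℤ) * p n) = 1 ↔ p n = 0 := by
        rw [← zpow_zero c, (injective_zpow_iff_not_isOfFinOrder.2 hc1).eq_iff]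
        simp [hN.ne']
      rw [h3, Nat.forall_lt_succ_right]
      simp [hN.ne']

end Words

/-! ### The mother group -/

theorem coe_rooted {d : ℕ} (a : Equiv.Perm (Fin d)) :
    ((rooted a : treeAut d) : Equiv.Perm (List (Fin d))) = letterPerm a := by
  ext1 w
  cases w <;> rfl

theorem coe_directed_mulSingle {d : ℕ} (y : Fin (d - 1)) (z : Fin d) (hz : (z : ℕ) = d - 1)
    (a : Equiv.Perm (Fin d)) :
    ((directed (Pi.mulSingle y a) 1 : treeAut d) : Equiv.Perm (List (Fin d)))
      = spinal (Fin.castLE (Nat.sub_le d 1) y) z a := by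
  ext1 w
  change directedFun _ _ w = spinalFun _ _ _ w
  induction w with
  | nil => simp [directedFun, spinalFun]
  | cons x w ih =>
    by_cases h : (x : ℕ) < d - 1
    · have hxz : x ≠ z := by rintro rfl; omega
      rw [directedFun, dif_pos h, spinalFun, if_neg hxz]
      by_cases hy : (⟨x, h⟩ : Fin (d - 1)) = y
      · subst hy
        rw [if_pos (by rfl), Pi.mulSingle_eq_same]
        cases w <;> rfl
      · rw [if_neg fun e => hy (by subst e; rfl), Pi.mulSingle_eq_of_ne hy]
        cases w <;> rfl
    · have hxz : x = z := Fin.ext (by have := x.2; omega)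
      rw [directedFun, dif_neg h, spinalFun, if_pos hxz, ih]

/-- The inclusion of the mother group into the permutations of the words. -/
def motherGroupHom (d : ℕ) : motherGroup d →* Equiv.Perm (List (Fin d)) :=
  (treeAut d).subtype.comp (motherGroup d).subtype

theorem motherGroupHom_injective (d : ℕ) : Function.Injective (motherGroupHom d) :=
  (treeAut d).subtype_injective.comp (motherGroup d).subtype_injective

theorem spinalGroup_le_range {d : ℕ} (y : Fin (d - 1)) (z : Fin d) (hz : (z : ℕ) = d - 1) :
    spinalGroup (Fin.castLE (Nat.sub_le d 1) y) z ≤ (motherGroupHom d).range := by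
  refine sup_le ?_ ?_
  · rintro _ ⟨a, rfl⟩
    exact ⟨⟨rooted a, Subgroup.subset_closure (Or.inl ⟨a, rfl⟩)⟩, coe_rooted a⟩
  · rintro _ ⟨a, rfl⟩
    exact ⟨⟨directed (Pi.mulSingle y a) 1,
      Subgroup.subset_closure (Or.inr ⟨⟨Pi.mulSingle y a, 1⟩, rfl⟩)⟩,
      coe_directed_mulSingle y z hz a⟩

/-! ### Finite balls and the coarse embedding -/

theorem motherGenSet_finite (d : ℕ) : (motherGenSet d).Finite :=
  Set.Finite.preimage Subtype.val_injective.injOn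
    ((Set.finite_range _).union (Set.finite_range _))

/-- Properness of the word metric, which replaces any estimate of distortion. -/
theorem finite_wordLength_le {G : Type*} [Group G] {S : Set G} (hfin : S.Finite)
    (hS : Subgroup.closure S = ⊤) (hinv : ∀ s ∈ S, s⁻¹ ∈ S) (n : ℕ) :
    {g | wordLength S g ≤ n}.Finite := by
  have : Finite S := hfin
  refine ((List.finite_length_le S n).image fun l => (l.map Subtype.val).prod).subset ?_
  intro g hg
  obtain ⟨l, hl, hl', hlg⟩ := Nat.sInf_mem (wordLengths_nonempty hS hinv g)
  refine ⟨l.attach.map fun s => ⟨s.1, hl' _ s.2⟩, ?_, ?_⟩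
  · simp only [Set.mem_ofPred_eq, List.length_map, List.length_attach]
    exact hl.trans_le hg
  · simpa [Function.comp_def] using hlg

theorem dist_eq_wordLength {d : ℕ} (g h : motherGroup d) :
    dist g h = (wordLength (motherGenSet d) (g * h⁻¹) : ℝ) := rfl

theorem exists_free_abelian_motherGroup {d : ℕ} (hd : 2 < d) (n : ℕ) :
    ∃ f : Multiplicative (ℕ → ℤ) →* motherGroup d,
      ∀ p : ℕ → ℤ, f (Multiplicative.ofAdd p) = 1 ↔ ∀ i < n, p i = 0 := by
  let y : Fin (d - 1) := ⟨0, by omega⟩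
  let z : Fin d := ⟨d - 1, by omega⟩
  obtain ⟨f, hf, hf1⟩ := exists_free_abelian (x := (⟨1, by omega⟩ : Fin d))
    (y := Fin.castLE (Nat.sub_le d 1) y) (z := z) (by simp [y, Fin.ext_iff])
    (by simp only [z, ne_eq, Fin.mk.injEq]; omega)
    (by simp only [y, z, ne_eq, Fin.ext_iff, Fin.val_castLE]; omega) n
  have hinj := motherGroupHom_injective d
  let f' : Multiplicative (ℕ → ℤ) →* motherGroup d :=
    (MonoidHom.ofInjective hinj).symm.toMonoidHom.comp
      (f.codRestrict (motherGroupHom d).range fun p => spinalGroup_le_range y z rfl (hf p))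
  refine ⟨f', fun p => ?_⟩
  rw [← hf1 p]
  change (MonoidHom.ofInjective hinj).symm _ = 1 ↔ _
  rw [MulEquiv.map_eq_one_iff, Subtype.ext_iff]
  rfl

theorem not_asdimLE_motherGroup {d : ℕ} (hd : 2 < d) (k : ℕ) : ¬ AsdimLE (motherGroup d) k := by
  obtain ⟨f, hf⟩ := exists_free_abelian_motherGroup hd (k + 1)
  let F : (ℕ → ℤ) → motherGroup d := fun p => f (Multiplicative.ofAdd p)
  have hF : ∀ p q, F p * (F q)⁻¹ = F (p - q) := fun p q => by
    simp only [F, ← map_inv, ← map_mul, ← ofAdd_neg, ← ofAdd_add, sub_eq_add_neg]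
  have hFeq : ∀ p q, F p = F q ↔ ∀ i < k + 1, p i = q i := fun p q => by
    rw [← mul_inv_eq_one, hF, hf]
    simp [sub_eq_zero]
  have hdist : ∀ p q, dist (F p) (F q) = (wordLength (motherGenSet d) (F (p - q)) : ℝ) :=
    fun p q => by rw [dist_eq_wordLength, hF]
  -- `F` sees only the first `k + 1` coordinates, so differences of adjacent points give finitely
  -- many group elements, and `C` bounds their lengths.
  let ext : (Fin (k + 1) → ℤ) → ℕ → ℤ := fun v i => if h : i < k + 1 then v ⟨i, h⟩ else 0
  obtain ⟨C, hC⟩ := ((Set.finite_Icc (-1 : Fin (k + 1) → ℤ) 1).image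
    fun v => wordLength (motherGenSet d) (F (ext v))).bddAbove
  refine not_asdimLE_of_coarse_embedding k F C (fun p q hpq => ?_) fun D => ?_
  · rw [hdist, Nat.cast_le]
    refine hC ⟨fun i => p i - q i, ⟨fun i => ?_, fun i => ?_⟩, ?_⟩
    · exact (abs_le.1 (hpq i i.2)).1
    · exact (abs_le.1 (hpq i i.2)).2
    · have : F (ext fun i => p i - q i) = F (p - q) := (hFeq _ _).2 fun i hi => dif_pos hi
      simp only [this]
  · have hfin := finite_wordLength_le (motherGenSet_finite d) (motherGenSet_closure d)
      (motherGenSet_inv d) ⌊D⌋₊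
    -- The first `k + 1` coordinates of `p` are determined by `F p`, hence uniformly bounded when `F
    -- p` ranges over a finite ball.
    have hbd : ∀ g : motherGroup d, ∃ E : ℕ, ∀ p, F p = g → ∀ i < k + 1, |p i| ≤ E := by
      intro g
      by_cases hg : ∃ p, F p = g
      · obtain ⟨p, rfl⟩ := hg
        refine ⟨∑ i ∈ Finset.range (k + 1), (p i).natAbs, fun q hq i hi => ?_⟩
        rw [(hFeq q p).1 hq i hi, Int.abs_eq_natAbs, Nat.cast_le]
        exact Finset.single_le_sum (f := fun i => (p i).natAbs) (fun _ _ => Nat.zero_le _)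
          (Finset.mem_range.2 hi)
      · exact ⟨0, fun p hp => absurd ⟨p, hp⟩ hg⟩
    choose E hE using hbd
    obtain ⟨m, hm⟩ := (hfin.image E).bddAbove
    refine ⟨m + 1, fun p q hpq i hi => ?_⟩
    have h1 : |(p - q) i| ≤ E (F (p - q)) := hE _ _ rfl i hi
    have h2 : E (F (p - q)) ≤ m := hm ⟨_, Nat.le_floor (by rwa [← hdist]), rfl⟩
    rw [Pi.sub_apply] at h1
    push_cast
    omega

theorem theorem3p4 (d : ℕ) (hd : 2 < d) : asdim (motherGroup d) = ⊤ := by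
  simp [asdim, not_asdimLE_motherGroup hd]
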